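/- Let $n,r\ge 1$ be integers, $e=(1,\dots,1)\in\mathbb R^n$ and $e_1,\dots,e_n$ the standard basis. Let $Hom_+(m,d)$ be the set of homogeneous real polynomials of degree $d$ in $m$ variables with nonnegative coefficients. Call $f\in Hom_+(m,m)$ doubly stochastic if $\partial f/\partial x_i(1,\dots,1)=1$ for all $i$ (for $m\ge 1$ this implies $f(1,\dots,1)=1$; for $m=0$ it means $f=1$), and put $$Cap(f)=\inf\{f(x): x_i>0,\ \textstyle\prod_i x_i=1\}.$$ Put $G(r)=\left(\frac{r-1}{r}\right)^{r-1}$, with $0^0=1$. Let $p\in Hom_+(n,n)$ be H-stable, i.e. $p(z_1,\dots,z_n)\ne 0$ whenever $z\in\mathbb C^n$ and $\mathrm{Re}\, z_i>0$ for all $i$, and let $p$ be $r$-regular, i.e. $$p(e+te_i)=\left(\frac{r+t}{r}\right)^r\qquad\text{for all } t\in\mathbb R,\ 1\le i\le n.$$ For $1\le j\le n$ let $q_{(j)}=\frac{\partial p}{\partial x_j}\big|_{x_j=0}$, a polynomial in the $n-1$ variables $x_k$, $k\neq j$. Then: 1. $p$ is doubly stochastic, and $Cap(p)=1$. 2. $G(r)^{-1}q_{(j)}\in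 Hom_+(n-1,n-1)$ is doubly stochastic for every $1\le j\le n$. 3. Consequently $$\frac{\partial^n p}{\partial x_1\cdots\partial x_n}(0)\ \ge\ \prod_{j=1}^n Cap(q_{(j)})\ =\ Cap(p)\prod_{j=1}^n\frac{Cap(q_{(j)})}{Cap(p)}.$$ In particular, if $p(x)=\prod_{i=1}^n\sum_{j=1}^n P(i,j)x_j$ for a doubly stochastic $n\times n$ matrix $P$, then $\mathrm{per}(P)\ge\prod_{j=1}^n Cap(q_{(j)})$. -/

import Mathlib

open MvPolynomial

noncomputable section

namespace HStab

variable {σ : Type*} [Fintype σ]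

/-- `Hom₊(σ, d)`: real polynomials in the variables `x_i`, `i ∈ σ`, that are homogeneous of
degree `d` and have nonnegative coefficients. -/
def HomPlus (σ : Type*) (d : ℕ) : Set (MvPolynomial σ ℝ) :=
  {p | p.IsHomogeneous d ∧ ∀ m, 0 ≤ p.coeff m}

/-- `p(z) ≠ 0` for all complex vectors `z` whose coordinates have positive real parts. -/
def HStable {σ : Type*} (p : MvPolynomial σ ℝ) : Prop :=
  ∀ z : σ → ℂ, (∀ i, 0 < (z i).re) → aeval z p ≠ 0

/-- The capacity: the infimum of `p(x)` over `x > 0` with `∏ x_i = 1`. -/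
def Cap (p : MvPolynomial σ ℝ) : ℝ :=
  sInf {c : ℝ | ∃ x : σ → ℝ, (∀ i, 0 < x i) ∧ ∏ i, x i = 1 ∧ c = eval x p}

/-- Doubly stochastic polynomials: `p ∈ Hom₊(n, n)`, where `n` is the number of variables, and
all first partial derivatives at the all-ones vector `e` are `1`. If `n ≥ 1`, then `p(e) = 1`
follows by Euler's identity; the middle clause matters only for `n = 0`, where it says that the
constant is `1`. -/
def IsDoublyStochastic (p : MvPolynomial σ ℝ) : Prop :=
  p ∈ HomPlus σ (Fintype.card σ) ∧ eval (fun _ => 1) p = 1 ∧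
    ∀ i, eval (fun _ => 1) (pderiv i p) = 1

/-- `p(e + t e_i) = ((r + t) / r) ^ r` for all `i` and all real `t`. -/
def IsRegular {σ : Type*} [DecidableEq σ] (r : ℕ) (p : MvPolynomial σ ℝ) : Prop :=
  ∀ (i : σ) (t : ℝ),
    eval ((fun _ => 1) + t • (Pi.single i 1 : σ → ℝ)) p = (((r : ℝ) + t) / r) ^ r

/-- `G(r) = ((r - 1) / r) ^ (r - 1)`, for `r ≥ 1`, with `G(1) = 0 ^ 0 = 1`. -/
def G (r : ℕ) : ℝ := (((r : ℝ) - 1) / r) ^ (r - 1)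

/-- `q_(j)`: the restriction of `∂p/∂x_j` to `x_j = 0`, as a polynomial in the remaining
variables `x_k`, `k ≠ j`. -/
def q {σ : Type*} [DecidableEq σ] (p : MvPolynomial σ ℝ) (j : σ) :
    MvPolynomial {k : σ // k ≠ j} ℝ :=
  aeval (fun k => if h : k ≠ j then X ⟨k, h⟩ else 0) (pderiv j p)

/-- The mixed derivative `∂ⁿp / ∂x_1 ⋯ ∂x_n` at `0`. -/
def mixedDeriv {n : ℕ} (p : MvPolynomial (Fin n) ℝ) : ℝ :=
  eval 0 ((List.finRange n).foldr (fun i f => pderiv i f) p)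

/-- The product polynomial `∏_i ∑_j P(i,j) x_j` of a square matrix `P`. -/
def prodPoly {n : ℕ} (P : Matrix (Fin n) (Fin n) ℝ) : MvPolynomial (Fin n) ℝ :=
  ∏ i, ∑ j, C (P i j) * X j

end HStab

end

/-!
The proof rests on Gurvits' capacity inequality. For `x > 0` the restriction `R(t)` of an H-stable
homogeneous polynomial `p` to the variable `x_j = t` has only real nonpositive roots
(`exists_nonpos_of_aeval_insertAt_eq_zero`). If moreover its degree is at most `r` and
`c t ≤ R(t)` for all `t > 0`, then the inequality of arithmetic and geometric means gives
`G(r) c ≤ R'(0)` (`G_mul_le_eval_derivative`). As `R'(0) = q_(j)(x)`, a bound `c ∏ x_i ≤ p(x)` on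
the positive orthant turns into `G(r) c ∏ x_k ≤ q_(j)(x)` (`G_mul_prod_le_eval_q`). Such lower
bounds by multiples of the product of the variables replace capacities throughout.

The polynomial `q_(j)` is again H-stable (`hStable_q`), which follows from the estimate
`p(Re z) ≤ |p(z)|` on the closed right half-plane (`eval_re_le_norm_aeval`). The capacity inequality
can therefore be iterated down to the coefficient of `∏ x_i`, which is the mixed derivative:
it is at least `G(r) ^ n c` (`G_pow_mul_le_coeff`).

Let now `p` be `r`-regular. Its degree in each variable is at most `r`, and `t = 0` and `t = -1` in
the regularity condition give `p(e) = ∂_i p(e) = 1` and `q_(j)(e) = G(r)`. The weighted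
inequality of arithmetic and geometric means gives `∏ x_i ≤ p(x)`, so `Cap p = 1`. Hence
`G(r) ∏ x_k ≤ q_(j)(x)` for `x > 0`, with equality at `x = e`. This shows that
`Cap q_(j) = G(r)`, and comparing gradients at the point of contact `e` shows that
`G(r)⁻¹ q_(j)` is doubly stochastic. Finally, `∏ Cap q_(j) = G(r) ^ n` is at most the mixed
derivative.
-/

namespace HStab

/-! ### Univariate polynomials with real nonpositive roots -/

/-- The inequality of arithmetic and geometric means for the numbers `1 + a`, `a ∈ s`, padded
with ones up to `r` factors. -/
lemma multiset_prod_one_add_le {r : ℕ} (hr : 1 ≤ r) (s : Multiset ℝ) (hs : ∀ a ∈ s, 0 ≤ a)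
    (hcard : s.card ≤ r) : (s.map (1 + ·)).prod ≤ (1 + s.sum / r) ^ r := by
  have hr0 : (0 : ℝ) < r := by exact_mod_cast hr
  have hS : 0 ≤ s.sum := Multiset.sum_nonneg hs
  set M : ℝ := 1 + s.sum / r with hM
  have hM1 : 1 ≤ M := by
    have : 0 ≤ s.sum / r := by positivity
    linarith
  have hM0 : 0 < M := by linarith
  -- each factor satisfies `y ≤ M * exp (y / M - 1)`, with equality at the mean `y = M`
  have key : ∀ u : Multiset ℝ, (∀ a ∈ u, 0 ≤ a) → 0 ≤ (u.map (1 + ·)).prod ∧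
      (u.map (1 + ·)).prod ≤ M ^ u.card * Real.exp ((u.card + u.sum) / M - u.card) := by
    intro u
    induction u using Multiset.induction_on with
    | empty => intro _; simp
    | cons a u ih =>
      intro hu
      obtain ⟨h0, h1⟩ := ih fun b hb => hu b (Multiset.mem_cons_of_mem hb)
      have ha : 0 ≤ a := hu a (Multiset.mem_cons_self a u)
      have h2 : 1 + a ≤ M * Real.exp ((1 + a) / M - 1) := by
        have := Real.add_one_le_exp ((1 + a) / M - 1)
        rw [sub_add_cancel, div_le_iff₀ hM0] at this
        linarith
      simp only [Multiset.map_cons, Multiset.prod_cons, Multiset.card_cons, Multiset.sum_cons]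
      refine ⟨by positivity, (mul_le_mul h2 h1 h0 (by positivity)).trans_eq ?_⟩
      rw [mul_mul_mul_comm, ← Real.exp_add, pow_succ' M]
      congr 2
      push_cast
      ring
  refine (key s hs).2.trans ?_
  -- the factors missing from `s` are accounted for by `exp (1 - 1 / M) ≤ M`
  obtain ⟨k, hk⟩ := Nat.exists_eq_add_of_le hcard
  have hk' : (r : ℝ) = s.card + k := by exact_mod_cast hk
  have hsum : s.sum = r * (M - 1) := by rw [hM]; field_simp; ring
  have hexp : Real.exp (1 - M⁻¹) ≤ M := by
    have h := Real.add_one_le_exp (M⁻¹ - 1)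
    rw [sub_add_cancel] at h
    rw [← neg_sub, Real.exp_neg]
    exact inv_le_of_inv_le₀ hM0 h
  have he : ((s.card : ℝ) + s.sum) / M - s.card = k * (1 - M⁻¹) := by
    rw [hsum, hk']; field_simp; ring
  rw [he, Real.exp_nat_mul, hk, pow_add]
  gcongr

lemma G_pos {r : ℕ} (hr : 1 ≤ r) : 0 < G r := by
  unfold G
  rcases hr.eq_or_lt with rfl | h
  · simp
  · have : (1 : ℝ) < r := by exact_mod_cast h
    have : (0 : ℝ) < r - 1 := by linarith
    positivity

lemma G_le_one {r : ℕ} (hr : 1 ≤ r) : G r ≤ 1 := by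
  have : (1 : ℝ) ≤ r := by exact_mod_cast hr
  exact pow_le_one₀ (div_nonneg (by linarith) (by linarith))
    (div_le_one_of_le₀ (by linarith) (by linarith))

/-- The optimization in `t` behind the constant `G r`. -/
lemma G_mul_le_of_forall_le_pow {r : ℕ} (hr : 1 ≤ r) {a c u : ℝ} (hc : 0 < c) (hu : 0 ≤ u)
    (h : ∀ t : ℝ, 0 < t → c * t ≤ a * (1 + t * u / r) ^ r) : G r * c ≤ a * u := by
  rcases hr.eq_or_lt with rfl | hr2
  · have h' : ∀ t : ℝ, 0 < t → c * t ≤ a * (1 + t * u) := by simpa using h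
    simp only [G, Nat.sub_self, pow_zero, one_mul]
    by_contra! hlt
    have h1 := h' (|a| / (c - a * u) + 1)
      (by have : 0 < c - a * u := by linarith
          positivity)
    have h2 : |a| / (c - a * u) * (c - a * u) = |a| := div_mul_cancel₀ _ (by linarith)
    nlinarith [le_abs_self a]
  · have hr1 : (1 : ℝ) < r := by exact_mod_cast hr2
    have hr0 : (0 : ℝ) < r - 1 := by linarith
    have hu0 : 0 < u := by
      refine hu.lt_of_ne fun h0 => ?_
      have h1 := h (|a| / c + 1) (by positivity)
      have h2 : c * (|a| / c) = |a| := mul_div_cancel₀ _ hc.ne'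
      rw [← h0] at h1
      simp only [mul_zero, zero_div, add_zero, one_pow, mul_one] at h1
      nlinarith [le_abs_self a]
    -- the minimizer of `(1 + t u / r) ^ r / t`
    have h1 := h (r / (u * (r - 1))) (by positivity)
    have e1 : 1 + (r : ℝ) / (u * (r - 1)) * u / r = r / (r - 1) := by
      field_simp; ring
    obtain ⟨k, rfl⟩ : ∃ k, r = k + 1 := ⟨r - 1, by omega⟩
    have hk : (((k + 1 : ℕ) : ℝ) - 1) = k := by push_cast; ring
    rw [e1] at h1
    simp only [G, hk, Nat.add_sub_cancel] at h1 hr0 ⊢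
    set n : ℝ := ((k + 1 : ℕ) : ℝ) with hn
    have hn0 : 0 < n := by linarith
    have h2 := mul_le_mul_of_nonneg_left h1 (show 0 ≤ (k / n) ^ k * (u * k / n) by positivity)
    have e2 : ((k : ℝ) / n) ^ k * (u * k / n) * (c * (n / (u * k))) = (k / n) ^ k * c := by
      field_simp
    have e3 : ((k : ℝ) / n) ^ k * (u * k / n) * (a * (n / k) ^ (k + 1)) = a * u := by
      rw [pow_succ, div_pow, div_pow]; field_simp
    rwa [e2, e3] at h2

/-- Gurvits' univariate inequality: if `R` has degree at most `r` and only real nonpositive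
roots, then `R'(0) ≥ G(r) inf_{t > 0} R(t) / t`. -/
lemma G_mul_le_eval_derivative {r : ℕ} (hr : 1 ≤ r) {R : Polynomial ℝ} (hR : R.Splits)
    (hdeg : R.natDegree ≤ r) (hroots : ∀ z ∈ R.roots, z ≤ 0) (h0 : 0 ≤ R.eval 0) {c : ℝ}
    (hc : 0 < c) (h : ∀ t : ℝ, 0 < t → c * t ≤ R.eval t) :
    G r * c ≤ R.derivative.eval 0 := by
  rcases h0.eq_or_lt with h0 | h0
  · obtain ⟨Q, rfl⟩ : Polynomial.X ∣ R := by
      rw [Polynomial.X_dvd_iff, Polynomial.coeff_zero_eq_eval_zero, ← h0]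
    have hlim : Filter.Tendsto (fun t => Q.eval t) (nhdsWithin 0 (Set.Ioi 0))
        (nhds (Q.eval 0)) := Q.continuous.continuousAt.tendsto.mono_left nhdsWithin_le_nhds
    have hQ : c ≤ Q.eval 0 := by
      refine ge_of_tendsto hlim (Filter.eventually_of_mem self_mem_nhdsWithin fun t ht => ?_)
      have ht : 0 < t := ht
      have := h t ht
      rw [Polynomial.eval_mul, Polynomial.eval_X, mul_comm] at this
      exact le_of_mul_le_mul_left this ht
    have e : (Polynomial.X * Q).derivative.eval 0 = Q.eval 0 := by simp
    rw [e]
    nlinarith [G_le_one hr]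
  · have hz : ∀ z ∈ R.roots, z < 0 := fun z hz => (hroots z hz).lt_of_ne <| by
      rintro rfl
      exact h0.ne' (Polynomial.isRoot_of_mem_roots hz)
    rw [hR.eval_derivative_eq_eval_mul_sum h0.ne']
    refine G_mul_le_of_forall_le_pow hr hc (Multiset.sum_nonneg ?_) fun t ht => ?_
    · intro x hx
      obtain ⟨z, hz', rfl⟩ := Multiset.mem_map.1 hx
      have := hz z hz'
      exact div_nonneg zero_le_one (by linarith)
    refine (h t ht).trans ?_
    have hfac : R.eval t =
        R.eval 0 * ((R.roots.map fun z => t * (1 / (0 - z))).map (1 + ·)).prod := by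
      rw [hR.eval_eq_prod_roots t, hR.eval_eq_prod_roots 0, mul_assoc, Multiset.map_map,
        ← Multiset.prod_map_mul]
      congr 2
      refine Multiset.map_congr rfl fun z hz' => ?_
      have := (hz z hz').ne
      simp only [Function.comp]
      field_simp
      ring
    rw [hfac, ← Multiset.sum_map_mul_left]
    refine mul_le_mul_of_nonneg_left (multiset_prod_one_add_le hr _ ?_ ?_) h0.le
    · intro x hx
      obtain ⟨z, hz', rfl⟩ := Multiset.mem_map.1 hx
      have := hz z hz'
      exact mul_nonneg ht.le (div_nonneg zero_le_one (by linarith))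
    · rw [Multiset.card_map]
      exact (Polynomial.card_roots' R).trans hdeg

/-! ### Evaluation of homogeneous polynomials with nonnegative coefficients -/

section Eval

lemma aeval_eq_eval_real {σ : Type*} (x : σ → ℝ) (p : MvPolynomial σ ℝ) :
    aeval x p = eval x p := rfl

lemma aeval_ofReal {σ : Type*} (x : σ → ℝ) (p : MvPolynomial σ ℝ) :
    aeval (fun i => (x i : ℂ)) p = ((eval x p : ℝ) : ℂ) := by
  rw [← aeval_eq_eval_real]
  exact aeval_algebraMap_apply ℂ x p

variable {σ : Type*} [Fintype σ]

lemma aeval_eq_sum_support {A : Type*} [CommRing A] [Algebra ℝ A] (f : σ → A)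
    (p : MvPolynomial σ ℝ) :
    aeval f p = ∑ m ∈ p.support, algebraMap ℝ A (p.coeff m) * ∏ i, f i ^ m i := by
  rw [aeval_def, eval₂_eq']

lemma weight_one_eq_sum (m : σ →₀ ℕ) : Finsupp.weight 1 m = ∑ i, m i := by
  rw [← Finsupp.degree_eq_sum, Finsupp.degree_eq_weight_one]
  rfl

lemma aeval_mul_of_isHomogeneous {A : Type*} [CommRing A] [Algebra ℝ A] {N : ℕ}
    {p : MvPolynomial σ ℝ} (hp : p.IsHomogeneous N) (w : A) (f : σ → A) :
    aeval (fun i => w * f i) p = w ^ N * aeval f p := by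
  rw [aeval_eq_sum_support, aeval_eq_sum_support, Finset.mul_sum]
  refine Finset.sum_congr rfl fun m hm => ?_
  have : ∑ i, m i = N := by
    rw [← weight_one_eq_sum, hp (mem_support_iff.1 hm)]
  simp_rw [mul_pow]
  rw [Finset.prod_mul_distrib, Finset.prod_pow_eq_pow_sum, this]
  ring

lemma continuous_aeval_complex (p : MvPolynomial σ ℝ) :
    Continuous fun z : σ → ℂ => aeval z p := by
  simp_rw [aeval_eq_sum_support]
  fun_prop

lemma eval_nonneg {p : MvPolynomial σ ℝ} (hp : ∀ m, 0 ≤ p.coeff m) {x : σ → ℝ}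
    (hx : ∀ i, 0 ≤ x i) : 0 ≤ eval x p := by
  rw [eval_eq']
  exact Finset.sum_nonneg fun m _ =>
    mul_nonneg (hp m) (Finset.prod_nonneg fun i _ => pow_nonneg (hx i) _)

lemma aeval_eq_zero_of_eval_eq_zero {p : MvPolynomial σ ℝ} (hp : ∀ m, 0 ≤ p.coeff m)
    {x : σ → ℝ} (hx : ∀ i, 0 ≤ x i) (h : eval x p = 0) {z : σ → ℂ}
    (hz : ∀ i, x i = 0 → z i = 0) : aeval z p = 0 := by
  rw [eval_eq', Finset.sum_eq_zero_iff_of_nonneg fun m _ =>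
    mul_nonneg (hp m) (Finset.prod_nonneg fun i _ => pow_nonneg (hx i) _)] at h
  rw [aeval_eq_sum_support]
  refine Finset.sum_eq_zero fun m hm => ?_
  rcases mul_eq_zero.1 (h m hm) with h0 | h0
  · simp [h0]
  · obtain ⟨i, -, hi⟩ := Finset.prod_eq_zero_iff.1 h0
    have hmi : m i ≠ 0 := fun h => by simp [h] at hi
    have h1 : z i ^ m i = 0 := by
      rw [hz i ((pow_eq_zero_iff hmi).1 hi), zero_pow hmi]
    rw [Finset.prod_eq_zero (Finset.mem_univ i) h1, mul_zero]

end Eval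

/-! ### Half-plane stability -/

section Stable

variable {σ : Type*} [Fintype σ]

lemma aeval_ne_zero_of_rotation {N : ℕ} {p : MvPolynomial σ ℝ} (hp : p.IsHomogeneous N)
    (hs : HStable p) {z : σ → ℂ} (w : ℂ) (hz : ∀ i, 0 < (w * z i).re) : aeval z p ≠ 0 := by
  intro h0
  apply hs _ hz
  rw [aeval_mul_of_isHomogeneous hp, h0, mul_zero]

/-- A complex polynomial with purely imaginary roots is at least as large at `1` as at `0`. -/
lemma norm_eval_zero_le_norm_eval_one {H : Polynomial ℂ} (h : ∀ w ∈ H.roots, w.re = 0) :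
    ‖H.eval 0‖ ≤ ‖H.eval 1‖ := by
  have hH : H.Splits := IsAlgClosed.splits H
  rw [hH.eval_eq_prod_roots 0, hH.eval_eq_prod_roots 1, norm_mul, norm_mul]
  refine mul_le_mul_of_nonneg_left ?_ (norm_nonneg _)
  generalize H.roots = s at h
  induction s using Multiset.induction_on with
  | empty => simp
  | cons a s ih =>
    simp only [Multiset.map_cons, Multiset.prod_cons, norm_mul]
    have ha := h a (Multiset.mem_cons_self a s)
    refine mul_le_mul ?_ (ih fun w hw => h w (Multiset.mem_cons_of_mem hw)) (norm_nonneg _)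
      (norm_nonneg _)
    rw [zero_sub, norm_neg, Complex.norm_def, Complex.norm_def]
    refine Real.sqrt_le_sqrt ?_
    simp [Complex.normSq_apply, ha]

lemma eval_re_le_norm_aeval_of_pos {N : ℕ} {p : MvPolynomial σ ℝ} (hp : p.IsHomogeneous N)
    (hs : HStable p) {z : σ → ℂ} (hz : ∀ i, 0 < (z i).re) :
    eval (fun i => (z i).re) p ≤ ‖aeval z p‖ := by
  -- the polynomial `w ↦ p (Re z + i w Im z)`, whose roots are purely imaginary
  set H : Polynomial ℂ := aeval (fun i => Polynomial.C ((z i).re : ℂ) +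
    Polynomial.X * Polynomial.C ((z i).im * Complex.I)) p with hH
  have hev : ∀ w, H.eval w = aeval (fun i => ((z i).re : ℂ) + w * ((z i).im * Complex.I)) p := by
    intro w
    rw [hH, aeval_eq_sum_support, aeval_eq_sum_support, Polynomial.eval_finsetSum]
    refine Finset.sum_congr rfl fun m _ => ?_
    simp [Polynomial.eval_prod, Polynomial.algebraMap_apply]
  have h0 : ‖H.eval 0‖ = |eval (fun i => (z i).re) p| := by
    rw [hev]
    simp only [zero_mul, add_zero]
    rw [aeval_ofReal, Complex.norm_real, Real.norm_eq_abs]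
  have h1 : H.eval 1 = aeval z p := by
    rw [hev]
    simp only [one_mul, Complex.re_add_im]
  rw [← h1]
  refine (le_abs_self _).trans (h0.symm.le.trans (norm_eval_zero_le_norm_eval_one ?_))
  intro w hw
  by_contra hre
  have hroot : H.eval w = 0 := Polynomial.isRoot_of_mem_roots hw
  rw [hev] at hroot
  have hw0 : w ≠ 0 := by rintro rfl; simp at hre
  have hrot : ∀ (ε : ℝ) (i : σ),
      ((ε * w⁻¹) * (((z i).re : ℂ) + w * ((z i).im * Complex.I))).re =
        ε * (w⁻¹).re * (z i).re := by
    intro ε i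
    have : (ε * w⁻¹) * (((z i).re : ℂ) + w * ((z i).im * Complex.I)) =
        ε * (w⁻¹ * ((z i).re : ℂ) + (z i).im * Complex.I) := by
      field_simp
    rw [this]
    simp [mul_assoc]
  have hinv : (w⁻¹).re ≠ 0 := by
    rw [Complex.inv_re]
    exact div_ne_zero hre (by simpa using hw0)
  refine aeval_ne_zero_of_rotation hp hs (((w⁻¹).re : ℂ) * w⁻¹) (fun i => ?_) hroot
  rw [hrot]
  have := hz i
  have := mul_self_pos.2 hinv
  positivity

/-- Moving the arguments of a homogeneous H-stable polynomial away from the real axis, within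
the closed right half-plane, increases its absolute value. -/
lemma eval_re_le_norm_aeval {N : ℕ} {p : MvPolynomial σ ℝ} (hp : p.IsHomogeneous N)
    (hs : HStable p) {z : σ → ℂ} (hz : ∀ i, 0 ≤ (z i).re) :
    eval (fun i => (z i).re) p ≤ ‖aeval z p‖ := by
  have hl : Filter.Tendsto (fun ε : ℝ => eval (fun i => (z i + (ε : ℂ)).re) p)
      (nhdsWithin 0 (Set.Ioi 0)) (nhds (eval (fun i => (z i).re) p)) := by
    have hc : Continuous fun ε : ℝ => eval (fun i => (z i + (ε : ℂ)).re) p := by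
      simp_rw [eval_eq']
      fun_prop
    have := hc.tendsto 0
    simp only [Complex.ofReal_zero, add_zero] at this
    exact this.mono_left nhdsWithin_le_nhds
  have hr : Filter.Tendsto (fun ε : ℝ => ‖aeval (fun i => z i + (ε : ℂ)) p‖)
      (nhdsWithin 0 (Set.Ioi 0)) (nhds ‖aeval z p‖) := by
    have hc : Continuous fun ε : ℝ => ‖aeval (fun i => z i + (ε : ℂ)) p‖ :=
      ((continuous_aeval_complex p).comp (by fun_prop)).norm
    have := hc.tendsto 0
    simp only [Complex.ofReal_zero, add_zero] at this
    exact this.mono_left nhdsWithin_le_nhds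
  refine le_of_tendsto_of_tendsto hl hr
    (Filter.eventually_of_mem self_mem_nhdsWithin fun ε hε => ?_)
  have hε : 0 < ε := hε
  refine eval_re_le_norm_aeval_of_pos hp hs fun i => ?_
  have := hz i
  simp only [Complex.add_re, Complex.ofReal_re]
  linarith

end Stable

/-! ### Restriction to one variable -/

section Slice

variable {σ : Type*} [DecidableEq σ] {A : Type*}

/-- The vector with coordinate `t` at `j` and the coordinates of `z` elsewhere. -/
def insertAt (j : σ) (z : {k : σ // k ≠ j} → A) (t : A) (k : σ) : A :=
  if h : k ≠ j then z ⟨k, h⟩ else t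

@[simp] lemma insertAt_self (j : σ) (z : {k : σ // k ≠ j} → A) (t : A) :
    insertAt j z t j = t := by simp [insertAt]

@[simp] lemma insertAt_coe (j : σ) (z : {k : σ // k ≠ j} → A) (t : A) (k : {k : σ // k ≠ j}) :
    insertAt j z t k = z k := by simp [insertAt, k.2]

lemma forall_insertAt {j : σ} {z : {k : σ // k ≠ j} → A} {t : A} {P : A → Prop}
    (ht : P t) (hz : ∀ k, P (z k)) (k : σ) : P (insertAt j z t k) := by
  unfold insertAt
  split_ifs
  exacts [hz _, ht]

lemma map_insertAt {B : Type*} (f : A → B) (j : σ)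
    (z : {k : σ // k ≠ j} → A) (t : A) (k : σ) :
    f (insertAt j z t k) = insertAt j (fun k => f (z k)) (f t) k := by
  unfold insertAt
  split_ifs <;> rfl

lemma prod_insertAt [Fintype σ] [CommMonoid A] (j : σ) (z : {k : σ // k ≠ j} → A) (t : A) :
    ∏ k, insertAt j z t k = t * ∏ k, z k := by
  rw [Fintype.prod_eq_mul_prod_subtype_ne _ j]
  simp

variable [CommRing A] [Algebra ℝ A]

/-- The polynomial `p` as a univariate polynomial in the variable `x_j`, with the other variables
set to `z`. -/
noncomputable def slice (j : σ) (z : {k : σ // k ≠ j} → A) (p : MvPolynomial σ ℝ) : Polynomial A :=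
  aeval (insertAt j (fun k => Polynomial.C (z k)) Polynomial.X) p

lemma eval_slice (j : σ) (z : {k : σ // k ≠ j} → A) (p : MvPolynomial σ ℝ) (t : A) :
    (slice j z p).eval t = aeval (insertAt j z t) p := by
  unfold slice
  induction p using MvPolynomial.induction_on with
  | C a => simp [Polynomial.algebraMap_apply]
  | add p q hp hq => simp [hp, hq]
  | mul_X p i hp =>
    rw [map_mul, map_mul, Polynomial.eval_mul, hp, aeval_X, aeval_X,
      map_insertAt (Polynomial.eval t)]
    simp

lemma derivative_slice (j : σ) (z : {k : σ // k ≠ j} → A) (p : MvPolynomial σ ℝ) :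
    (slice j z p).derivative = slice j z (pderiv j p) := by
  unfold slice
  induction p using MvPolynomial.induction_on with
  | C a => simp [Polynomial.algebraMap_apply]
  | add p q hp hq => simp [hp, hq]
  | mul_X p i hp =>
    rw [map_mul, Polynomial.derivative_mul, hp, pderiv_mul, map_add, map_mul, map_mul, aeval_X]
    congr 2
    by_cases h : i = j
    · subst h; simp
    · rw [pderiv_X_of_ne h, map_zero, insertAt, dif_pos h, Polynomial.derivative_C]

/-- The polynomial `q_(j)` is the linear coefficient of `p` in `x_j`. -/
lemma eval_zero_derivative_slice (j : σ) (z : {k : σ // k ≠ j} → A) (p : MvPolynomial σ ℝ) :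
    (slice j z p).derivative.eval 0 = aeval z (q p j) := by
  rw [derivative_slice, eval_slice, q, ← AlgHom.comp_apply, comp_aeval]
  congr 2
  funext k
  unfold insertAt
  split_ifs <;> simp

lemma natDegree_slice_le [Fintype σ] (j : σ) (z : {k : σ // k ≠ j} → A) {p : MvPolynomial σ ℝ}
    {r : ℕ} (h : ∀ m ∈ p.support, m j ≤ r) : (slice j z p).natDegree ≤ r := by
  unfold slice
  rw [aeval_eq_sum_support]
  refine Polynomial.natDegree_sum_le_of_forall_le _ _ fun m hm => ?_
  rw [Polynomial.algebraMap_apply]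
  refine (Polynomial.natDegree_C_mul_le _ _).trans ((Polynomial.natDegree_prod_le _ _).trans ?_)
  have : ∀ k, (insertAt j (fun k => Polynomial.C (z k)) Polynomial.X k ^ m k).natDegree ≤
      if k = j then m j else 0 := by
    intro k
    refine Polynomial.natDegree_pow_le.trans ?_
    by_cases hk : k = j
    · subst hk
      rw [insertAt_self, if_pos rfl]
      exact (Nat.mul_le_mul_left _ Polynomial.natDegree_X_le).trans (by simp)
    · simp [insertAt, hk]
  exact (Finset.sum_le_sum fun k _ => this k).trans (by simpa using h m hm)

end Slice

/-! ### Coefficients of `q_(j)` -/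

section Coeff

variable {σ : Type*} [DecidableEq σ]

lemma coeff_q (p : MvPolynomial σ ℝ) (j : σ) (m : {k : σ // k ≠ j} →₀ ℕ) :
    coeff m (q p j) = coeff (m.extendDomain + Finsupp.single j 1) p := by
  have hj : ∀ m : {k : σ // k ≠ j} →₀ ℕ, m.extendDomain j = 0 := fun m => by
    simp [Finsupp.extendDomain_apply]
  have main : ∀ f : MvPolynomial σ ℝ,
      coeff m (aeval (fun k => if h : k ≠ j then X ⟨k, h⟩ else 0 :
        σ → MvPolynomial {k : σ // k ≠ j} ℝ) f) = coeff m.extendDomain f := by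
    intro f
    induction f using MvPolynomial.induction_on' with
    | add f g hf hg => simp only [map_add, coeff_add, hf, hg]
    | monomial d a =>
      rw [aeval_monomial, coeff_monomial]
      by_cases hd : d j = 0
      · have hd' : d = (d.subtypeDomain (· ≠ j)).extendDomain := by
          rw [Finsupp.extendDomain_subtypeDomain]
          rintro k hk rfl
          exact (Finsupp.mem_support_iff.1 hk) hd
        have hprod : (d.prod fun k n => (if h : k ≠ j then X ⟨k, h⟩ else 0 :
            MvPolynomial {k : σ // k ≠ j} ℝ) ^ n) = monomial (d.subtypeDomain (· ≠ j)) 1 := by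
          rw [monomial_eq, C_1, one_mul]
          refine (Finsupp.prod_subtypeDomain_index (p := (· ≠ j))
            (h := fun k n => (if h : k ≠ j then X ⟨k, h⟩ else 0 :
              MvPolynomial {k : σ // k ≠ j} ℝ) ^ n) ?_).symm.trans ?_
          · rintro k hk rfl
            exact (Finsupp.mem_support_iff.1 hk) hd
          · refine Finsupp.prod_congr fun k _ => ?_
            rw [dif_pos k.2]
        rw [hprod, MvPolynomial.algebraMap_eq, C_mul_monomial, mul_one, coeff_monomial]
        congr 1
        refine propext ⟨fun h => by rw [hd', h], fun h => ?_⟩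
        rw [h, Finsupp.subtypeDomain_extendDomain]
      · have hz : (d.prod fun k n => (if h : k ≠ j then X ⟨k, h⟩ else 0 :
            MvPolynomial {k : σ // k ≠ j} ℝ) ^ n) = 0 :=
          Finset.prod_eq_zero (Finsupp.mem_support_iff.2 hd) (by simp [hd])
        rw [hz, mul_zero, coeff_zero, if_neg]
        rintro rfl
        exact hd (hj m)
  rw [q, main, coeff_pderiv, hj]
  simp

lemma card_ne_add_one [Fintype σ] (j : σ) : Fintype.card {k : σ // k ≠ j} + 1 = Fintype.card σ := by
  have : 0 < Fintype.card σ := Fintype.card_pos_iff.2 ⟨j⟩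
  rw [Fintype.card_subtype_compl, Fintype.card_subtype_eq]
  omega

lemma q_mem_HomPlus [Fintype σ] {p : MvPolynomial σ ℝ} (hp : p ∈ HomPlus σ (Fintype.card σ)) (j : σ) :
    q p j ∈ HomPlus {k : σ // k ≠ j} (Fintype.card {k : σ // k ≠ j}) := by
  refine ⟨fun m hm => ?_, fun m => (coeff_q p j m).symm ▸ hp.2 _⟩
  rw [coeff_q] at hm
  have h := hp.1 hm
  rw [weight_one_eq_sum] at h ⊢
  have h1 : ∑ k, (m.extendDomain + Finsupp.single j 1 : σ →₀ ℕ) k = (∑ k, m k) + 1 := by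
    rw [Fintype.sum_eq_add_sum_subtype_ne _ j, add_comm]
    congr 1
    · refine Finset.sum_congr rfl fun k _ => ?_
      rw [Finsupp.add_apply, Finsupp.single_eq_of_ne k.2, add_zero,
        Finsupp.extendDomain_apply, dif_pos k.2]
    · simp [Finsupp.extendDomain_apply]
  rw [h1, ← card_ne_add_one j] at h
  exact Nat.succ_injective h

lemma q_degree_le {p : MvPolynomial σ ℝ} {r : ℕ} (h : ∀ m ∈ p.support, ∀ i, m i ≤ r) (j : σ) :
    ∀ m ∈ (q p j).support, ∀ i, m i ≤ r := by
  intro m hm i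
  rw [mem_support_iff, coeff_q] at hm
  refine le_trans ?_ (h _ (mem_support_iff.2 hm) i)
  rw [Finsupp.add_apply, Finsupp.extendDomain_apply, dif_pos i.2]
  exact Nat.le_add_right _ _

end Coeff

/-! ### The capacity inequality -/

section Capacity

variable {σ : Type*} [DecidableEq σ]

lemma map_slice_ofReal (j : σ) (x : {k : σ // k ≠ j} → ℝ) (p : MvPolynomial σ ℝ) :
    (slice j x p).map Complex.ofRealHom = slice j (fun k => (x k : ℂ)) p := by
  unfold slice
  induction p using MvPolynomial.induction_on with
  | C a => simp [Polynomial.algebraMap_apply]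
  | add p q hp hq => simp [hp, hq]
  | mul_X p i hp =>
    rw [map_mul, map_mul, Polynomial.map_mul, hp, aeval_X, aeval_X,
      map_insertAt (Polynomial.map Complex.ofRealHom)]
    simp

variable [Fintype σ]

/-- In a positive direction, an H-stable homogeneous polynomial has only real nonpositive
roots: otherwise all arguments could be rotated into the open right half-plane. -/
lemma exists_nonpos_of_aeval_insertAt_eq_zero {N : ℕ} {p : MvPolynomial σ ℝ}
    (hp : p.IsHomogeneous N) (hs : HStable p) {j : σ} {x : {k : σ // k ≠ j} → ℝ}
    (hx : ∀ k, 0 < x k) {t : ℂ} (h : aeval (insertAt j (fun k => (x k : ℂ)) t) p = 0) :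
    ∃ s : ℝ, s ≤ 0 ∧ (s : ℂ) = t := by
  by_contra! hne
  have hpos : 0 < ‖t‖ + t.re := by
    refine lt_of_le_of_ne (by linarith [neg_le_of_abs_le (Complex.abs_re_le_norm t)]) ?_
    intro h0
    have hle : t.re ≤ 0 := by linarith [norm_nonneg t]
    refine hne t.re hle (Complex.ext rfl ?_)
    have h1 : ‖t‖ ^ 2 = t.re ^ 2 + t.im ^ 2 := by
      rw [← Complex.normSq_eq_norm_sq, Complex.normSq_apply]; ring
    have h2 : ‖t‖ = -t.re := by linarith
    rw [h2] at h1
    have : t.im ^ 2 = 0 := by linarith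
    simpa using (pow_eq_zero_iff two_ne_zero).1 this |>.symm
  have ht : 0 < ‖t‖ := by
    rcases (norm_nonneg t).eq_or_lt with h0 | h0
    · rw [norm_eq_zero.1 h0.symm] at hpos
      simp at hpos
    · exact h0
  -- multiplication by `|t| + conj t` halves the angle between the positive axis and `t`
  refine aeval_ne_zero_of_rotation hp hs (‖t‖ + (starRingEnd ℂ) t)
    (forall_insertAt (P := fun a => 0 < ((‖t‖ + (starRingEnd ℂ) t) * a).re) ?_ fun k => ?_) h
  · have : (‖t‖ + (starRingEnd ℂ) t) * t = ‖t‖ * (t + ‖t‖) := by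
      rw [add_mul, mul_comm ((starRingEnd ℂ) t), Complex.mul_conj, Complex.normSq_eq_norm_sq]
      push_cast
      ring
    rw [this, Complex.re_ofReal_mul]
    simp only [Complex.add_re, Complex.ofReal_re]
    exact mul_pos ht (by linarith)
  · rw [Complex.re_mul_ofReal]
    simp only [Complex.add_re, Complex.ofReal_re, Complex.conj_re]
    exact mul_pos hpos (hx k)

/-- Gurvits' capacity inequality, in terms of lower bounds by multiples of `∏ x_i`: passing from
`p` to `q_(j)` costs at most a factor `G(r)`. -/
lemma G_mul_prod_le_eval_q {r : ℕ} (hr : 1 ≤ r) {p : MvPolynomial σ ℝ}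
    (hp : p ∈ HomPlus σ (Fintype.card σ)) (hs : HStable p)
    (hdeg : ∀ m ∈ p.support, ∀ i, m i ≤ r) {c : ℝ} (hc : 0 < c)
    (hlb : ∀ x : σ → ℝ, (∀ i, 0 < x i) → c * ∏ i, x i ≤ eval x p) (j : σ)
    (x : {k : σ // k ≠ j} → ℝ) (hx : ∀ k, 0 < x k) :
    G r * c * ∏ k, x k ≤ eval x (q p j) := by
  have hroot : ∀ z ∈ ((slice j x p).map Complex.ofRealHom).roots, ∃ s : ℝ, s ≤ 0 ∧ (s : ℂ) = z := by
    intro z hz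
    have := Polynomial.isRoot_of_mem_roots hz
    rw [map_slice_ofReal, Polynomial.IsRoot, eval_slice] at this
    exact exists_nonpos_of_aeval_insertAt_eq_zero hp.1 hs hx this
  have hsplit : (slice j x p).Splits :=
    Polynomial.Splits.of_splits_map Complex.ofRealHom (IsAlgClosed.splits _) fun z hz => by
      obtain ⟨s, -, rfl⟩ := hroot z hz
      exact ⟨s, rfl⟩
  have hev : ∀ t, (slice j x p).eval t = eval (insertAt j x t) p := fun t => by
    rw [eval_slice, aeval_eq_eval_real]
  have h := G_mul_le_eval_derivative (c := c * ∏ k, x k) hr hsplit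
    (natDegree_slice_le j x fun m hm => hdeg m hm j) (fun z hz => ?_) ?_
    (mul_pos hc (Finset.prod_pos fun k _ => hx k)) (fun t ht => ?_)
  · rwa [eval_zero_derivative_slice, ← mul_assoc, aeval_eq_eval_real] at h
  · obtain ⟨s, hs0, hsz⟩ := hroot z (by
      rw [hsplit.roots_map]
      exact Multiset.mem_map_of_mem _ hz)
    rwa [← Complex.ofReal_injective hsz]
  · rw [hev]
    exact eval_nonneg hp.2 (forall_insertAt le_rfl fun k => (hx k).le)
  · rw [hev]
    have := hlb (insertAt j x t) (forall_insertAt ht hx)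
    rw [prod_insertAt] at this
    linarith

/-- `H`-stability passes from `p` to `q_(j)`. When `p` vanishes for `x_j = 0`, the growth of `p`
along the `x_j`-axis gives `q_(j)(z) ≠ 0`. Otherwise the roots of `p` in `x_j` lie in the open
left half-plane, so that the logarithmic derivative at `0` does not vanish. -/
lemma hStable_q {p : MvPolynomial σ ℝ}
    (hp : p ∈ HomPlus σ (Fintype.card σ)) (hs : HStable p) {c : ℝ} (hc : 0 < c)
    (hlb : ∀ x : σ → ℝ, (∀ i, 0 < x i) → c * ∏ i, x i ≤ eval x p) (j : σ) :
    HStable (q p j) := by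
  intro z hz
  set x : {k : σ // k ≠ j} → ℝ := fun k => (z k).re with hxdef
  set R : Polynomial ℂ := slice j z p with hR
  have hre : ∀ t : ℂ, (fun i => (insertAt j z t i).re) = insertAt j x t.re := fun t =>
    funext fun i => map_insertAt Complex.re j z t i
  have hnorm : ∀ t : ℂ, 0 ≤ t.re → eval (insertAt j x t.re) p ≤ ‖R.eval t‖ := by
    intro t ht
    rw [hR, eval_slice, ← hre]
    exact eval_re_le_norm_aeval hp.1 hs
      (forall_insertAt (P := fun a : ℂ => 0 ≤ a.re) ht fun k => (hz k).le)
  have hP : 0 < c * ∏ k, x k := mul_pos hc (Finset.prod_pos fun k _ => hz k)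
  have hgrow : ∀ t : ℝ, 0 < t → c * (∏ k, x k) * t ≤ ‖R.eval (t : ℂ)‖ := by
    intro t ht
    refine le_trans ?_ (hnorm t (by simpa using ht.le))
    rw [Complex.ofReal_re]
    have := hlb (insertAt j x t) (forall_insertAt ht hz)
    rw [prod_insertAt] at this
    linarith
  rw [← eval_zero_derivative_slice, ← hR]
  intro hder
  have h0 : 0 ≤ eval (insertAt j x 0) p :=
    eval_nonneg hp.2 (forall_insertAt le_rfl fun k => (hz k).le)
  rcases h0.eq_or_lt with h0 | h0
  · have hR0 : R.eval 0 = 0 := by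
      rw [hR, eval_slice]
      refine aeval_eq_zero_of_eval_eq_zero hp.2
        (forall_insertAt le_rfl fun k => (hz k).le) h0.symm fun i => ?_
      by_cases hi : i = j
      · subst hi; simp
      · simp only [insertAt, ne_eq, hi, not_false_eq_true, dite_true]
        exact fun h => absurd h (hz ⟨i, hi⟩).ne'
    obtain ⟨Q, hQ⟩ : Polynomial.X ∣ R := by
      rw [Polynomial.X_dvd_iff, Polynomial.coeff_zero_eq_eval_zero, hR0]
    rw [hQ] at hder hgrow
    have hQ0 : Q.eval 0 = 0 := by simpa using hder
    have hlim : Filter.Tendsto (fun t : ℝ => ‖Q.eval (t : ℂ)‖) (nhdsWithin 0 (Set.Ioi 0))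
        (nhds 0) := by
      have hcont : Continuous fun t : ℝ => ‖Q.eval (t : ℂ)‖ :=
        (Q.continuous.comp Complex.continuous_ofReal).norm
      have := hcont.tendsto 0
      simp only [Complex.ofReal_zero, hQ0, norm_zero] at this
      exact this.mono_left nhdsWithin_le_nhds
    have hle : c * ∏ k, x k ≤ 0 := by
      refine ge_of_tendsto hlim (Filter.eventually_of_mem self_mem_nhdsWithin fun t ht => ?_)
      have ht : 0 < t := ht
      have := hgrow t ht
      rw [Polynomial.eval_mul, Polynomial.eval_X, norm_mul, Complex.norm_real,
        Real.norm_of_nonneg ht.le, mul_comm] at this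
      exact le_of_mul_le_mul_left this ht
    exact hP.not_ge hle
  · have hR0 : R.eval 0 ≠ 0 := by
      have := h0.trans_le (hnorm 0 le_rfl)
      exact norm_pos_iff.1 this
    have hroots : ∀ w ∈ R.roots, w.re < 0 := by
      intro w hw
      by_contra! hw0
      have h1 := hnorm w hw0
      rw [Polynomial.isRoot_of_mem_roots hw, norm_zero] at h1
      refine h1.not_gt (h0.trans_le ?_)
      rw [eval_eq', eval_eq']
      refine Finset.sum_le_sum fun m _ => mul_le_mul_of_nonneg_left ?_ (hp.2 m)
      refine Finset.prod_le_prod (fun i _ => pow_nonneg ?_ _) fun i _ => pow_le_pow_left₀ ?_ ?_ _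
      · exact forall_insertAt (P := fun a : ℝ => 0 ≤ a) le_rfl (fun k => (hz k).le) i
      · exact forall_insertAt (P := fun a : ℝ => 0 ≤ a) le_rfl (fun k => (hz k).le) i
      · unfold insertAt
        split_ifs
        exacts [le_rfl, hw0]
    have hsp : R.Splits := IsAlgClosed.splits R
    rw [hsp.eval_derivative_eq_eval_mul_sum hR0, mul_eq_zero, or_iff_right hR0] at hder
    have hempty : R.roots = 0 := by
      by_contra hne
      have hpos : ∀ s : Multiset ℂ, (∀ w ∈ s, w.re < 0) → s ≠ 0 →
          0 < (s.map fun w => 1 / (0 - w)).sum.re := by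
        intro s
        induction s using Multiset.induction_on with
        | empty => intro _ h; exact absurd rfl h
        | cons a s ih =>
          intro hs' _
          have ha := hs' a (Multiset.mem_cons_self a s)
          have h1 : 0 < (1 / (0 - a)).re := by
            rw [one_div, Complex.inv_re]
            refine div_pos (by simpa using ha) (Complex.normSq_pos.2 ?_)
            intro h
            rw [zero_sub, neg_eq_zero] at h
            simp [h] at ha
          rw [Multiset.map_cons, Multiset.sum_cons, Complex.add_re]
          rcases eq_or_ne s 0 with rfl | hs0
          · simpa using h1
          · linarith [ih (fun w hw => hs' w (Multiset.mem_cons_of_mem hw)) hs0]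
      have := hpos _ hroots hne
      rw [hder] at this
      simp at this
    -- without roots, `p` would be constant in `x_j`, contrary to its growth
    have hconst : ∀ t, R.eval t = R.leadingCoeff := fun t => by
      rw [hsp.eval_eq_prod_roots, hempty]
      simp
    have h1 := hgrow (‖R.leadingCoeff‖ / (c * ∏ k, x k) + 1) (by positivity)
    rw [hconst, mul_add, mul_div_cancel₀ _ hP.ne'] at h1
    linarith

end Capacity

/-- Iterating the capacity inequality bounds the coefficient of `∏ x_i` from below. -/
lemma G_pow_mul_le_coeff {r : ℕ} (hr : 1 ≤ r) (n : ℕ) : ∀ {σ : Type*} [Fintype σ]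
    (_ : Fintype.card σ = n) {p : MvPolynomial σ ℝ}
    (_ : p ∈ HomPlus σ (Fintype.card σ)) (_ : HStable p)
    (_ : ∀ m ∈ p.support, ∀ i, m i ≤ r) {c : ℝ} (_ : 0 < c)
    (_ : ∀ x : σ → ℝ, (∀ i, 0 < x i) → c * ∏ i, x i ≤ eval x p),
    G r ^ n * c ≤ coeff (Finsupp.equivFunOnFinite.symm fun _ => 1) p := by
  classical
  induction n with
  | zero =>
    intro σ _ hcard p _ _ _ c _ hlb
    have : IsEmpty σ := Fintype.card_eq_zero_iff.1 hcard
    have h := hlb (fun _ => 1) fun _ => one_pos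
    obtain ⟨a, rfl⟩ := C_surjective σ p
    have h0 : (Finsupp.equivFunOnFinite.symm fun _ : σ => 1) = 0 := Subsingleton.elim _ _
    rw [h0, coeff_C, if_pos rfl]
    simpa using h
  | succ n ih =>
    intro σ _ hcard p hp hs hdeg c hc hlb
    have : Nonempty σ := Fintype.card_pos_iff.1 (by omega)
    obtain ⟨j⟩ := this
    have hcard' : Fintype.card {k : σ // k ≠ j} = n := by
      have := card_ne_add_one j
      omega
    have h := ih hcard' (q_mem_HomPlus hp j) (hStable_q hp hs hc hlb j) (q_degree_le hdeg j)
      (mul_pos (G_pos hr) hc) (G_mul_prod_le_eval_q hr hp hs hdeg hc hlb j)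
    rw [coeff_q] at h
    have e : (Finsupp.equivFunOnFinite.symm fun _ : {k : σ // k ≠ j} => 1).extendDomain +
        Finsupp.single j 1 = (Finsupp.equivFunOnFinite.symm fun _ : σ => 1) := by
      ext k
      by_cases hk : k = j
      · subst hk
        simp [Finsupp.extendDomain_apply]
      · simp [Finsupp.extendDomain_apply, hk]
    rwa [e, ← mul_assoc, ← pow_succ] at h

/-! ### Doubly stochastic and regular polynomials -/

section DoublyStochastic

lemma insertAt_one {σ : Type*} [DecidableEq σ] (j : σ) : insertAt j (fun _ => (1 : ℝ)) 1 = fun _ => 1 := by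
  funext k
  unfold insertAt
  split_ifs <;> rfl

lemma eval_one_pderiv {σ : Type*} (p : MvPolynomial σ ℝ) (i : σ) :
    eval (fun _ => 1) (pderiv i p) = ∑ m ∈ p.support, p.coeff m * m i := by
  conv_lhs => rw [← p.support_sum_monomial_coeff, map_sum, map_sum]
  refine Finset.sum_congr rfl fun m _ => ?_
  simp [pderiv_monomial, eval_monomial]

variable {σ : Type*} [Fintype σ]

/-- The weighted inequality of arithmetic and geometric means, applied to the monomials of `p`
with their coefficients as weights. -/
lemma prod_le_eval {p : MvPolynomial σ ℝ} (hp : ∀ m, 0 ≤ p.coeff m)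
    (h1 : eval (fun _ => 1) p = 1) (hd : ∀ i, eval (fun _ => 1) (pderiv i p) = 1)
    {x : σ → ℝ} (hx : ∀ i, 0 < x i) : ∏ i, x i ≤ eval x p := by
  have hsum : ∑ m ∈ p.support, p.coeff m = 1 := by
    rw [← h1, eval_eq']
    simp
  have h := Real.geom_mean_le_arith_mean_weighted p.support (fun m => p.coeff m)
    (fun m => ∏ i, x i ^ m i) (fun m _ => hp m) hsum
    (fun m _ => Finset.prod_nonneg fun i _ => pow_nonneg (hx i).le _)
  rw [← eval_eq'] at h
  refine le_trans (le_of_eq ?_) h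
  have : ∀ m ∈ p.support, (∏ i, x i ^ m i) ^ p.coeff m = ∏ i, x i ^ (p.coeff m * m i) := by
    intro m _
    rw [← Real.finsetProd_rpow _ _ fun i _ => pow_nonneg (hx i).le _]
    refine Finset.prod_congr rfl fun i _ => ?_
    rw [mul_comm, Real.rpow_mul (hx i).le, Real.rpow_natCast]
  rw [Finset.prod_congr rfl this, Finset.prod_comm]
  refine Finset.prod_congr rfl fun i _ => ?_
  rw [← Real.rpow_sum_of_pos (hx i), ← eval_one_pderiv, hd, Real.rpow_one]

lemma cap_eq_of_forall_le {p : MvPolynomial σ ℝ} {c : ℝ} (h1 : eval (fun _ => 1) p = c)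
    (h : ∀ x : σ → ℝ, (∀ i, 0 < x i) → c * ∏ i, x i ≤ eval x p) : Cap p = c := by
  refine IsLeast.csInf_eq ⟨⟨fun _ => 1, fun _ => one_pos, by simp, h1.symm⟩, ?_⟩
  rintro _ ⟨x, hx, hprod, rfl⟩
  simpa [hprod] using h x hx

lemma IsDoublyStochastic.inv_smul {p : MvPolynomial σ ℝ} {c : ℝ} (hc : 0 < c)
    (hp : p ∈ HomPlus σ (Fintype.card σ)) (h1 : eval (fun _ => 1) p = c)
    (hd : ∀ i, eval (fun _ => 1) (pderiv i p) = c) : IsDoublyStochastic (c⁻¹ • p) := by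
  refine ⟨⟨?_, fun m => ?_⟩, ?_, fun i => ?_⟩
  · rw [smul_eq_C_mul]
    exact hp.1.C_mul _
  · rw [coeff_smul, smul_eq_mul]
    exact mul_nonneg (inv_nonneg.2 hc.le) (hp.2 m)
  · rw [smul_eval, h1, inv_mul_cancel₀ hc.ne']
  · rw [Derivation.map_smul, smul_eval, hd, inv_mul_cancel₀ hc.ne']

variable [DecidableEq σ]

/-- If `c ∏ x_i ≤ p(x)` for `x > 0`, with equality at `x = e`, then `p` and `c ∏ x_i` have the
same gradient at `e`. -/
lemma eval_one_pderiv_eq_of_forall_le {p : MvPolynomial σ ℝ} {c : ℝ}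
    (h1 : eval (fun _ => 1) p = c)
    (h : ∀ x : σ → ℝ, (∀ i, 0 < x i) → c * ∏ i, x i ≤ eval x p) (i : σ) :
    eval (fun _ => 1) (pderiv i p) = c := by
  set S : Polynomial ℝ := slice i (fun _ => (1 : ℝ)) p - Polynomial.C c * Polynomial.X with hS
  have hev : ∀ s, S.eval s = eval (insertAt i (fun _ => 1) s) p - c * s := fun s => by
    rw [hS, Polynomial.eval_sub, eval_slice, aeval_eq_eval_real]
    simp
  have hmin : IsLocalMin (fun s => S.eval s) 1 := by
    filter_upwards [lt_mem_nhds (zero_lt_one' ℝ)] with s hs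
    have hle := h (insertAt i (fun _ => 1) s) (forall_insertAt hs fun _ => one_pos)
    rw [prod_insertAt, Finset.prod_const_one, mul_one] at hle
    rw [hev, hev, insertAt_one, h1]
    linarith
  have hder := hmin.hasDerivAt_eq_zero (S.hasDerivAt 1)
  rw [hS, Polynomial.derivative_sub, Polynomial.eval_sub, derivative_slice, eval_slice,
    aeval_eq_eval_real, insertAt_one] at hder
  simp only [Polynomial.derivative_C_mul, Polynomial.derivative_X, mul_one,
    Polynomial.eval_C] at hder
  linarith

end DoublyStochastic

section Regular

variable {σ : Type*} [DecidableEq σ]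

lemma IsRegular.slice_one_eq {r : ℕ} {p : MvPolynomial σ ℝ} (h : IsRegular r p) (i : σ) :
    slice i (fun _ => (1 : ℝ)) p =
      (Polynomial.C (r : ℝ)⁻¹ * (Polynomial.X + Polynomial.C ((r : ℝ) - 1))) ^ r := by
  refine Polynomial.funext fun s => ?_
  have e : insertAt i (fun _ => (1 : ℝ)) s =
      (fun _ => 1) + (s - 1) • (Pi.single i 1 : σ → ℝ) := by
    funext k
    by_cases hk : k = i
    · subst hk; simp
    · simp [insertAt, hk]
  rw [eval_slice, aeval_eq_eval_real, e, h i (s - 1)]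
  simp only [Polynomial.eval_pow, Polynomial.eval_mul, Polynomial.eval_C, Polynomial.eval_add,
    Polynomial.eval_X]
  congr 1
  ring

lemma IsRegular.derivative_slice_one_eq {r : ℕ} (hr : 1 ≤ r) {p : MvPolynomial σ ℝ}
    (h : IsRegular r p) (i : σ) (s : ℝ) :
    (slice i (fun _ => (1 : ℝ)) p).derivative.eval s = ((s + (r - 1)) / r) ^ (r - 1) := by
  have hr0 : (r : ℝ) ≠ 0 := by positivity
  rw [h.slice_one_eq, Polynomial.derivative_pow]
  simp only [Polynomial.derivative_C_mul, Polynomial.derivative_X_add_C, mul_one,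
    Polynomial.eval_pow, Polynomial.eval_mul, Polynomial.eval_C, Polynomial.eval_add,
    Polynomial.eval_X]
  rw [div_eq_inv_mul]
  field_simp

lemma IsRegular.eval_one_pderiv_eq {r : ℕ} (hr : 1 ≤ r) {p : MvPolynomial σ ℝ}
    (h : IsRegular r p) (i : σ) : eval (fun _ => 1) (pderiv i p) = 1 := by
  have h1 := h.derivative_slice_one_eq hr i 1
  have hr0 : (r : ℝ) ≠ 0 := by positivity
  rwa [derivative_slice, eval_slice, aeval_eq_eval_real, insertAt_one, add_sub_cancel,
    div_self hr0, one_pow] at h1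

lemma IsRegular.eval_one_q {r : ℕ} (hr : 1 ≤ r) {p : MvPolynomial σ ℝ}
    (h : IsRegular r p) (j : σ) : eval (fun _ => 1) (q p j) = G r := by
  have h1 := h.derivative_slice_one_eq hr j 0
  rwa [eval_zero_derivative_slice, aeval_eq_eval_real, zero_add] at h1

/-- Since coefficients are nonnegative, nothing cancels in the restriction of `p` to `e + t e_i`,
which therefore shows the degree of `p` in `x_i`. -/
lemma IsRegular.degree_le [Fintype σ] {r : ℕ} {p : MvPolynomial σ ℝ}
    (hp : ∀ m, 0 ≤ p.coeff m) (h : IsRegular r p) :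
    ∀ m ∈ p.support, ∀ i, m i ≤ r := by
  intro m hm i
  by_contra! hlt
  have hdeg : (slice i (fun _ => (1 : ℝ)) p).natDegree ≤ r := by
    rw [h.slice_one_eq]
    refine Polynomial.natDegree_pow_le.trans ?_
    have := (Polynomial.natDegree_C_mul_le (r : ℝ)⁻¹
      (Polynomial.X + Polynomial.C ((r : ℝ) - 1))).trans_eq (Polynomial.natDegree_X_add_C _)
    simpa using Nat.mul_le_mul_left r this
  have hcoeff : (slice i (fun _ => (1 : ℝ)) p).coeff (m i) =
      ∑ d ∈ p.support, if m i = d i then p.coeff d else 0 := by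
    unfold slice
    rw [aeval_eq_sum_support, Polynomial.finsetSum_coeff]
    refine Finset.sum_congr rfl fun d _ => ?_
    rw [Fintype.prod_eq_mul_prod_subtype_ne _ i]
    simp [Polynomial.coeff_X_pow]
  rw [Polynomial.coeff_eq_zero_of_natDegree_lt (hdeg.trans_lt hlt)] at hcoeff
  have hle := Finset.single_le_sum (f := fun d => if m i = d i then p.coeff d else 0)
    (fun d _ => by split_ifs; exacts [hp d, le_rfl]) hm
  simp only [if_true] at hle
  rw [← hcoeff] at hle
  exact mem_support_iff.1 hm (le_antisymm hle (hp m))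

end Regular

/-! ### Mixed derivatives and permanents -/

lemma coeff_foldr_pderiv {σ : Type*} [DecidableEq σ] (p : MvPolynomial σ ℝ) (l : List σ)
    (hl : l.Nodup) (m : σ →₀ ℕ) (hm : ∀ i ∈ l, m i = 0) :
    coeff m (l.foldr (fun i f => pderiv i f) p) =
      coeff (m + (l.map fun i => Finsupp.single i 1).sum) p := by
  induction l generalizing m with
  | nil => simp
  | cons a l ih =>
    rw [List.nodup_cons] at hl
    rw [List.foldr_cons, coeff_pderiv, ih hl.2, hm a List.mem_cons_self]
    · simp [add_assoc]
    · intro i hi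
      have hne : a ≠ i := by rintro rfl; exact hl.1 hi
      simp [hm i (List.mem_cons_of_mem a hi), hne]

lemma mixedDeriv_eq_coeff {n : ℕ} (p : MvPolynomial (Fin n) ℝ) :
    mixedDeriv p = coeff (Finsupp.equivFunOnFinite.symm fun _ => 1) p := by
  have h0 : ∀ f : MvPolynomial (Fin n) ℝ, eval 0 f = coeff 0 f := fun f => by
    rw [← constantCoeff_eq, eval_zero]
  rw [mixedDeriv, h0, coeff_foldr_pderiv p _ (List.nodup_finRange n) 0 (by simp), zero_add]
  congr 1
  ext k
  rw [← List.ofFn_eq_map, List.sum_ofFn, Finsupp.finsetSum_apply]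
  simp [Finsupp.single_apply]

lemma coeff_prodPoly {n : ℕ} (P : Matrix (Fin n) (Fin n) ℝ) :
    coeff (Finsupp.equivFunOnFinite.symm fun _ => 1) (prodPoly P) = P.permanent := by
  have hmono : ∀ f : Fin n → Fin n, ∏ i, (C (P i (f i)) * X (f i) : MvPolynomial (Fin n) ℝ) =
      monomial (∑ i, Finsupp.single (f i) 1) (∏ i, P i (f i)) := by
    intro f
    rw [monomial_sum_prod]
    refine Finset.prod_congr rfl fun i _ => ?_
    rw [X, C_mul_monomial, mul_one]
  rw [prodPoly, Finset.prod_univ_sum, coeff_sum, ← Matrix.permanent_transpose, Matrix.permanent]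
  symm
  refine Finset.sum_of_injOn (fun e : Equiv.Perm (Fin n) => (e : Fin n → Fin n))
    (fun _ _ _ _ h => DFunLike.coe_injective h) (fun _ _ => by simp) ?_ ?_
  · intro f _ hf
    rw [hmono, coeff_monomial, if_neg]
    intro h
    have hsurj : Function.Surjective f := by
      intro k
      by_contra! hk
      have := DFunLike.congr_fun h k
      rw [Finsupp.finsetSum_apply] at this
      simp [hk] at this
    exact hf ⟨Equiv.ofBijective f (Finite.surjective_iff_bijective.1 hsurj), by simp, rfl⟩
  · intro e _
    rw [hmono, coeff_monomial, if_pos]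
    · rfl
    · ext k
      rw [Finsupp.finsetSum_apply, Equiv.sum_comp e fun j => Finsupp.single j 1 k]
      simp [Finsupp.single_apply]

end HStab

open HStab

theorem mainTheorem11 (n : ℕ) (hn : 1 ≤ n) (r : ℕ) (hr : 1 ≤ r)
    (p : MvPolynomial (Fin n) ℝ) (hp : p ∈ HStab.HomPlus (Fin n) n)
    (hstab : HStab.HStable p) (hreg : HStab.IsRegular r p) :
    -- `p` itself is doubly stochastic and has capacity one
    (HStab.IsDoublyStochastic p ∧ HStab.Cap p = 1) ∧
    -- each `G(r)⁻¹ q_(j)` is doubly stochastic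
    (∀ j, HStab.IsDoublyStochastic ((HStab.G r)⁻¹ • HStab.q p j)) ∧
    -- the conjectured inequality, for the mixed derivative of `p`
    ∏ j, HStab.Cap (HStab.q p j) ≤ HStab.mixedDeriv p ∧
    HStab.Cap p * ∏ j, (HStab.Cap (HStab.q p j) / HStab.Cap p) ≤ HStab.mixedDeriv p ∧
    -- the same for permanents, when `p` is the product polynomial of a doubly stochastic matrix
    (∀ P ∈ doublyStochastic ℝ (Fin n), p = HStab.prodPoly P →
      ∏ j, HStab.Cap (HStab.q p j) ≤ P.permanent) := by
  have hp' : p ∈ HomPlus (Fin n) (Fintype.card (Fin n)) := by rwa [Fintype.card_fin]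
  have hone : eval (fun _ => 1) p = 1 := by
    have hr0 : (r : ℝ) ≠ 0 := by positivity
    have h := hreg ⟨0, hn⟩ 0
    rw [zero_smul, add_zero, add_zero, div_self hr0, one_pow] at h
    exact h
  have hgrad := hreg.eval_one_pderiv_eq hr
  have hlb : ∀ x : Fin n → ℝ, (∀ i, 0 < x i) → 1 * ∏ i, x i ≤ eval x p := fun x hx => by
    rw [one_mul]
    exact prod_le_eval hp.2 hone hgrad hx
  have hdeg := hreg.degree_le hp.2
  have hqlb : ∀ j, ∀ x : {k // k ≠ j} → ℝ, (∀ k, 0 < x k) →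
      G r * ∏ k, x k ≤ eval x (q p j) := fun j x hx => by
    simpa using G_mul_prod_le_eval_q hr hp' hstab hdeg one_pos hlb j x hx
  have hcap : Cap p = 1 := cap_eq_of_forall_le hone hlb
  have hcapq : ∀ j, Cap (q p j) = G r := fun j =>
    cap_eq_of_forall_le (hreg.eval_one_q hr j) (hqlb j)
  have hmain : ∏ j, Cap (q p j) ≤ mixedDeriv p := by
    rw [Finset.prod_congr rfl fun j _ => hcapq j, Finset.prod_const, Finset.card_univ,
      Fintype.card_fin, mixedDeriv_eq_coeff]
    simpa using G_pow_mul_le_coeff hr n (Fintype.card_fin n) hp' hstab hdeg one_pos hlb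
  refine ⟨⟨⟨hp', hone, hgrad⟩, hcap⟩, fun j => ?_, hmain, ?_, ?_⟩
  · exact IsDoublyStochastic.inv_smul (G_pos hr) (q_mem_HomPlus hp' j) (hreg.eval_one_q hr j)
      (eval_one_pderiv_eq_of_forall_le (hreg.eval_one_q hr j) (hqlb j))
  · simpa [hcap] using hmain
  · rintro P - rfl
    rwa [mixedDeriv_eq_coeff, coeff_prodPoly] at hmain
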